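/- Let $m>1$ be a squarefree integer and let $k\ge 2$ be an integer, written as $k=d\,2^{s}$ with $d$ odd and $s\ge 0$. Suppose that every prime $p$ dividing $m$ satisfies $p\equiv 1\pmod{2^{s+1}}$. Let $A\subset\mathbb{Z}/m\mathbb{Z}$ be a set that does not contain two distinct elements whose difference is a $k$-th power, that is, there are no distinct $x,y\in A$ with $x-y=z^{k}$ for some $z\in\mathbb{Z}/m\mathbb{Z}$. Then $$|A|<m^{1-\frac1k}.$$ -/

import Mathlib

open Finset

/-! This is Delsarte's linear programming method. In `ZMod p`, take `W = η + (Gaussian period)`,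
where `-η` is the least period. Then `W ≥ 0`, and since `-1` is a `k`-th power, its Fourier
transform lives on the `k`-th powers. `W` is also a nonnegative combination of characters, with
constant coefficient `η`, and it vanishes on a full coset of the nonzero powers. A product of `k`
dilates therefore vanishes off `0`, and averaging it gives `p * η ^ k ≤ W 0 ^ k`. Hence `∑ W = p * η
≤ p ^ (1 - 1/k) * W 0`. A non-power modulo `m` is a non-power modulo some `p ∣ m`, so products of
these weights serve for `ZMod m`. Equality would make `m ^ (k - 1)` a `k`-th power. -/

/-- A linear programming bound for sets whose nonzero differences are zeros of a function with
nonnegative Fourier coefficients. -/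
theorem card_mul_weight_le_sum {G κ : Type*} [AddCommGroup G] [Finite G] [Fintype κ]
    (χ : κ → AddChar G ℂ) (w : κ → ℝ) (hw : ∀ t, 0 ≤ w t) (t₀ : κ) (ht₀ : χ t₀ = 1)
    (A : Finset G)
    (hA : ∀ x ∈ A, ∀ y ∈ A, x ≠ y → ∑ t, (w t : ℂ) * χ t (x - y) = 0) :
    (#A : ℝ) * w t₀ ≤ ∑ t, w t := by
  have h1 : ∑ x ∈ A, ∑ y ∈ A, ∑ t, (w t : ℂ) * χ t (x - y) = #A * ∑ t, (w t : ℂ) := by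
    have : ∀ x ∈ A, ∑ y ∈ A, ∑ t, (w t : ℂ) * χ t (x - y) = ∑ t, (w t : ℂ) := by
      intro x hx
      rw [Finset.sum_eq_single_of_mem x hx]
      · simp
      · intro y hy hne
        exact hA x hx y hy hne.symm
    rw [Finset.sum_congr rfl this]
    simp
  have h2 : ∑ x ∈ A, ∑ y ∈ A, ∑ t, (w t : ℂ) * χ t (x - y)
      = ∑ t, ((w t * Complex.normSq (∑ x ∈ A, χ t x) : ℝ) : ℂ) := by
    calc _ = ∑ x ∈ A, ∑ t, ∑ y ∈ A, (w t : ℂ) * χ t (x - y) :=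
          Finset.sum_congr rfl fun x _ => Finset.sum_comm
      _ = ∑ t, ∑ x ∈ A, ∑ y ∈ A, (w t : ℂ) * χ t (x - y) := Finset.sum_comm
      _ = _ := by
        refine Finset.sum_congr rfl fun t _ => ?_
        rw [Complex.ofReal_mul, ← Complex.mul_conj, map_sum, Finset.sum_mul_sum, Finset.mul_sum]
        refine Finset.sum_congr rfl fun x _ => ?_
        rw [Finset.mul_sum]
        refine Finset.sum_congr rfl fun y _ => ?_
        rw [sub_eq_add_neg, AddChar.map_add_eq_mul, AddChar.map_neg_eq_conj]
  have h3 : (#A : ℝ) * ∑ t, w t = ∑ t, w t * Complex.normSq (∑ x ∈ A, χ t x) := by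
    exact_mod_cast h1.symm.trans h2
  -- Only the trivial character's term is kept; all others are nonnegative.
  have h4 : w t₀ * (#A * #A) ≤ (#A : ℝ) * ∑ t, w t := by
    rw [h3]
    refine le_trans (le_of_eq ?_) (Finset.single_le_sum
      (fun t _ => mul_nonneg (hw t) (Complex.normSq_nonneg _)) (Finset.mem_univ t₀))
    simp [ht₀]
  rcases A.eq_empty_or_nonempty with rfl | hne
  · simpa using Finset.sum_nonneg fun t _ => hw t
  · have : (0 : ℝ) < #A := by exact_mod_cast hne.card_pos
    nlinarith

/-! ### Gaussian periods and the weight on one finite field. -/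

section FiniteField

variable {F : Type*} [Field F] [Fintype F] [DecidableEq F]

/-- The nonzero `k`-th powers of a finite field. -/
def nonzeroPowers (F : Type*) [Field F] [Fintype F] [DecidableEq F] (k : ℕ) : Finset F :=
  univ.filter fun x => x ≠ 0 ∧ ∃ z, z ^ k = x

theorem mem_nonzeroPowers {k : ℕ} {x : F} :
    x ∈ nonzeroPowers F k ↔ x ≠ 0 ∧ ∃ z, z ^ k = x := by
  simp [nonzeroPowers]

theorem mul_mem_nonzeroPowers {k : ℕ} {x y : F} (hx : x ∈ nonzeroPowers F k)
    (hy : y ∈ nonzeroPowers F k) : x * y ∈ nonzeroPowers F k := by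
  rw [mem_nonzeroPowers] at *
  obtain ⟨hx, z, rfl⟩ := hx
  obtain ⟨hy, w, rfl⟩ := hy
  exact ⟨mul_ne_zero hx hy, z * w, mul_pow z w k⟩

theorem inv_mem_nonzeroPowers {k : ℕ} {x : F} (hx : x ∈ nonzeroPowers F k) :
    x⁻¹ ∈ nonzeroPowers F k := by
  rw [mem_nonzeroPowers] at *
  obtain ⟨hx, z, rfl⟩ := hx
  exact ⟨inv_ne_zero hx, z⁻¹, inv_pow z k⟩

theorem one_mem_nonzeroPowers (k : ℕ) : (1 : F) ∈ nonzeroPowers F k :=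
  mem_nonzeroPowers.2 ⟨one_ne_zero, 1, one_pow k⟩

theorem neg_mem_nonzeroPowers {k : ℕ} (h : ∃ z : F, z ^ k = -1) {x : F}
    (hx : x ∈ nonzeroPowers F k) : -x ∈ nonzeroPowers F k := by
  rw [← neg_one_mul]
  exact mul_mem_nonzeroPowers (mem_nonzeroPowers.2 ⟨by simp, h⟩) hx

/-- The powers `g ^ i`, `i < k`, of a generator represent all classes modulo `k`-th powers. -/
theorem exists_pow_mul_mem_nonzeroPowers {k : ℕ} (hk : 0 < k) :
    ∃ g : F, g ≠ 0 ∧ ∀ y : F, y ≠ 0 → ∃ i : Fin k, g ^ (i : ℕ) * y ∈ nonzeroPowers F k := by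
  obtain ⟨g, hg⟩ := IsCyclic.exists_generator (α := Fˣ)
  refine ⟨g, g.ne_zero, fun y hy => ?_⟩
  obtain ⟨n, hn⟩ := (mem_powers_iff_mem_zpowers (x := g)).2 (hg (Units.mk0 y hy))
  have hy' : y = (g : F) ^ n := by
    have := congrArg Units.val hn
    simpa using this.symm
  -- The exponent is `-n` modulo `k`, written without subtracting `n`.
  refine ⟨⟨((k - 1) * n) % k, Nat.mod_lt _ hk⟩, ?_⟩
  have hdvd : k ∣ ((k - 1) * n) % k + n := by
    rw [Nat.dvd_iff_mod_eq_zero, Nat.mod_add_mod]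
    obtain ⟨j, rfl⟩ : ∃ j, k = j + 1 := ⟨k - 1, by omega⟩
    rw [Nat.add_sub_cancel, show j * n + n = (j + 1) * n by ring, Nat.mul_mod_right]
  obtain ⟨c, hc⟩ := hdvd
  rw [hy', ← pow_add, hc]
  exact mem_nonzeroPowers.2 ⟨pow_ne_zero _ g.ne_zero, (g : F) ^ c, by rw [← pow_mul, mul_comm]⟩

variable (ψ : AddChar F ℂ)

/-- The real part of the Gaussian period `∑ u, ψ (u * x)`, `u` a nonzero `k`-th power. -/
noncomputable def gaussianPeriod (k : ℕ) (x : F) : ℝ :=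
  ∑ u ∈ nonzeroPowers F k, (ψ (u * x)).re

/-- As `-1` is a `k`-th power, `u ↦ -u` permutes the summands and conjugates them. -/
theorem ofReal_gaussianPeriod {k : ℕ} (h : ∃ z : F, z ^ k = -1) (x : F) :
    (gaussianPeriod ψ k x : ℂ) = ∑ u ∈ nonzeroPowers F k, ψ (u * x) := by
  have hconj : (starRingEnd ℂ) (∑ u ∈ nonzeroPowers F k, ψ (u * x))
      = ∑ u ∈ nonzeroPowers F k, ψ (u * x) := by
    rw [map_sum]
    refine Finset.sum_nbij' (fun u => -u) (fun u => -u)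
      (fun u hu => neg_mem_nonzeroPowers h hu) (fun u hu => neg_mem_nonzeroPowers h hu)
      (by simp) (by simp) fun u _ => ?_
    rw [← AddChar.map_neg_eq_conj, neg_mul]
  rw [← Complex.conj_eq_iff_re.1 hconj]
  simp [gaussianPeriod]

theorem gaussianPeriod_mul {k : ℕ} {v : F} (hv : v ∈ nonzeroPowers F k) (x : F) :
    gaussianPeriod ψ k (v * x) = gaussianPeriod ψ k x := by
  have hv0 := (mem_nonzeroPowers.1 hv).1
  refine Finset.sum_nbij' (fun u => u * v) (fun u => u * v⁻¹)
      (fun u hu => mul_mem_nonzeroPowers hu hv)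
      (fun u hu => mul_mem_nonzeroPowers hu (inv_mem_nonzeroPowers hv))
      (fun u _ => by field_simp) (fun u _ => by field_simp) fun u _ => ?_
  rw [mul_assoc]

theorem gaussianPeriod_zero (k : ℕ) : gaussianPeriod ψ k 0 = #(nonzeroPowers F k) := by
  simp [gaussianPeriod]

variable {ψ}

theorem sum_gaussianPeriod (hψ : ψ.IsPrimitive) (k : ℕ) : ∑ x, gaussianPeriod ψ k x = 0 := by
  unfold gaussianPeriod
  rw [Finset.sum_comm]
  refine Finset.sum_eq_zero fun u hu => ?_
  have h := AddChar.sum_mulShift u hψ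
  rw [if_neg (mem_nonzeroPowers.1 hu).1] at h
  have h' := congrArg Complex.re h
  simpa [mul_comm] using h'

/-- The periods sum to zero but the one at `0` is positive, so the minimum is negative and attained
elsewhere. -/
theorem exists_gaussianPeriod_neg_min (hψ : ψ.IsPrimitive) (k : ℕ) :
    ∃ x₀ : F, x₀ ≠ 0 ∧ gaussianPeriod ψ k x₀ < 0 ∧
      ∀ x, gaussianPeriod ψ k x₀ ≤ gaussianPeriod ψ k x := by
  obtain ⟨x₀, -, hmin⟩ := Finset.exists_min_image univ (gaussianPeriod ψ k) univ_nonempty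
  have hpos : 0 < gaussianPeriod ψ k 0 := by
    rw [gaussianPeriod_zero]
    exact_mod_cast Finset.card_pos.2 ⟨1, one_mem_nonzeroPowers k⟩
  have hneg : gaussianPeriod ψ k x₀ < 0 := by
    by_contra! hcon
    have := Finset.sum_pos' (fun x _ => hcon.trans (hmin x (mem_univ x))) ⟨0, mem_univ _, hpos⟩
    exact this.ne' (sum_gaussianPeriod hψ k)
  exact ⟨x₀, fun h => by rw [h] at hneg; linarith, hneg, fun x => hmin x (mem_univ x)⟩

theorem AddChar.map_finset_sum {ι A M : Type*} [AddCommMonoid A] [CommMonoid M]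
    (ψ : AddChar A M) (s : Finset ι) (f : ι → A) : ψ (∑ i ∈ s, f i) = ∏ i ∈ s, ψ (f i) :=
  map_prod ψ.toMonoidHom (fun i => Multiplicative.ofAdd (f i)) s

/-- The mean of a product of dilates of a nonnegative combination of characters is at least the
product of the constant coefficients. -/
theorem card_mul_pow_le_of_prod_eq_zero (hψ : ψ.IsPrimitive) {k : ℕ}
    (v : F → ℝ) (hv : ∀ t, 0 ≤ v t) (W : F → ℝ)
    (hW : ∀ x, (W x : ℂ) = ∑ t, (v t : ℂ) * ψ (t * x)) (g : F)
    (hz : ∀ x, x ≠ 0 → ∃ i : Fin k, W (g ^ (i : ℕ) * x) = 0) :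
    Fintype.card F * v 0 ^ k ≤ W 0 ^ k := by
  have h1 : ∑ x, ∏ i : Fin k, (W (g ^ (i : ℕ) * x) : ℂ) = (W 0 : ℂ) ^ k := by
    rw [Finset.sum_eq_single_of_mem 0 (mem_univ _)]
    · simp
    · intro x _ hx
      obtain ⟨i, hi⟩ := hz x hx
      exact Finset.prod_eq_zero (mem_univ i) (by rw [hi, Complex.ofReal_zero])
  have h2 : ∑ x, ∏ i : Fin k, (W (g ^ (i : ℕ) * x) : ℂ)
      = ∑ τ : Fin k → F, ((∏ i, v (τ i)) *
        (if ∑ i, τ i * g ^ (i : ℕ) = 0 then (Fintype.card F : ℝ) else 0) : ℝ) := by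
    simp_rw [hW, Finset.prod_univ_sum, Fintype.piFinset_univ, Finset.prod_mul_distrib]
    rw [Finset.sum_comm, Complex.ofReal_sum]
    refine Finset.sum_congr rfl fun τ _ => ?_
    rw [← Finset.mul_sum, Complex.ofReal_mul, Complex.ofReal_prod]
    congr 1
    have h := AddChar.sum_mulShift (∑ i, τ i * g ^ (i : ℕ)) hψ
    rw [show (((if ∑ i, τ i * g ^ (i : ℕ) = 0 then (Fintype.card F : ℝ) else 0 : ℝ)) : ℂ)
      = ∑ x, ψ (x * ∑ i, τ i * g ^ (i : ℕ)) by rw [h]; split_ifs <;> simp]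
    refine Finset.sum_congr rfl fun x _ => ?_
    rw [← AddChar.map_finset_sum, Finset.mul_sum]
    congr 1
    exact Finset.sum_congr rfl fun i _ => by ring
  have h3 : W 0 ^ k = ∑ τ : Fin k → F, (∏ i, v (τ i)) *
        (if ∑ i, τ i * g ^ (i : ℕ) = 0 then (Fintype.card F : ℝ) else 0) := by
    exact_mod_cast h1.symm.trans h2
  rw [h3]
  -- Only `τ = 0`, the product of the constant coefficients, is kept.
  refine le_trans (le_of_eq ?_) (Finset.single_le_sum
      (f := fun τ : Fin k → F => (∏ i, v (τ i)) *
        (if ∑ i, τ i * g ^ (i : ℕ) = 0 then (Fintype.card F : ℝ) else 0))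
      (fun τ _ => mul_nonneg (Finset.prod_nonneg fun i _ => hv _) (by split_ifs <;> positivity))
      (Finset.mem_univ (0 : Fin k → F)))
  simp [mul_comm]

/-- A nonnegative function whose Fourier transform vanishes off the `k`-th powers, and which
carries a large share of its mass at the origin. -/
theorem exists_weight_fourier_supported_on_powers (hψ : ψ.IsPrimitive) {k : ℕ} (hk : 0 < k)
    (hneg : ∃ z : F, z ^ k = -1) :
    ∃ W : F → ℝ, (∀ t, 0 ≤ W t) ∧ 0 < W 0 ∧
      (∀ x, (¬ ∃ z : F, x = z ^ k) → ∑ t, (W t : ℂ) * ψ (t * x) = 0) ∧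
      (∑ t, W t) ^ k ≤ W 0 ^ k * (Fintype.card F : ℝ) ^ (k - 1) := by
  obtain ⟨x₀, hx₀, hlt, hmin⟩ := exists_gaussianPeriod_neg_min hψ k
  set η : ℝ := -gaussianPeriod ψ k x₀ with hη
  have hηpos : 0 < η := by linarith
  have hW0 : ∀ t, 0 ≤ η + gaussianPeriod ψ k t := fun t => by linarith [hmin t]
  have hsum : ∑ t, (η + gaussianPeriod ψ k t) = Fintype.card F * η := by
    rw [Finset.sum_add_distrib, sum_gaussianPeriod hψ]
    simp
  refine ⟨fun t => η + gaussianPeriod ψ k t, hW0, ?_, ?_, ?_⟩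
  · simp only [gaussianPeriod_zero]
    positivity
  · intro x hx
    have hx0 : x ≠ 0 := fun h => hx ⟨0, by rw [h, zero_pow hk.ne']⟩
    simp only [Complex.ofReal_add, add_mul, Finset.sum_add_distrib, ofReal_gaussianPeriod ψ hneg]
    rw [← Finset.mul_sum, AddChar.sum_mulShift x hψ, if_neg hx0]
    simp_rw [Finset.sum_mul, ← AddChar.map_add_eq_mul]
    rw [Finset.sum_comm, Finset.sum_eq_zero]
    · simp
    intro u hu
    have hux : u + x ≠ 0 := by
      intro h
      have hmem := neg_mem_nonzeroPowers hneg hu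
      rw [neg_eq_of_add_eq_zero_right h] at hmem
      obtain ⟨-, z, hz⟩ := mem_nonzeroPowers.1 hmem
      exact hx ⟨z, hz.symm⟩
    have h := AddChar.sum_mulShift (u + x) hψ
    rw [if_neg hux, Nat.cast_zero] at h
    rw [← h]
    exact Finset.sum_congr rfl fun t _ => by congr 1; ring
  · obtain ⟨g, hg, hgk⟩ := exists_pow_mul_mem_nonzeroPowers (F := F) hk
    have h0 : (0 : F) ∉ nonzeroPowers F k := fun h => (mem_nonzeroPowers.1 h).1 rfl
    have key := card_mul_pow_le_of_prod_eq_zero hψ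
      -- These are the coefficients of `W` as a combination of characters.
      (fun t => (if t = 0 then η else 0) + if t ∈ nonzeroPowers F k then 1 else 0)
      (fun t => add_nonneg (by split_ifs <;> linarith) (by split_ifs <;> norm_num))
      (fun t => η + gaussianPeriod ψ k t)
      (fun x => by
        simp only [Complex.ofReal_add, ofReal_gaussianPeriod ψ hneg, add_mul,
          Finset.sum_add_distrib]
        congr 1
        · rw [Finset.sum_eq_single_of_mem 0 (mem_univ _)]
          · simp
          · intro t _ ht
            simp [ht]
        · rw [← Finset.sum_filter_add_sum_filter_not univ (· ∈ nonzeroPowers F k)]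
          rw [Finset.sum_eq_zero (s := univ.filter (· ∉ nonzeroPowers F k)), add_zero]
          · rw [Finset.filter_univ_mem]
            exact Finset.sum_congr rfl fun t ht => by simp [ht]
          · intro t ht
            simp [(Finset.mem_filter.1 ht).2]) g
      (fun x hx => by
        -- This dilate moves `x` into the coset of `x₀`, where the period is `-η`.
        obtain ⟨i, hi⟩ := hgk (x * x₀⁻¹) (mul_ne_zero hx (inv_ne_zero hx₀))
        refine ⟨i, ?_⟩
        have : g ^ (i : ℕ) * x = g ^ (i : ℕ) * (x * x₀⁻¹) * x₀ := by field_simp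
        rw [this, gaussianPeriod_mul ψ hi, hη]
        ring)
    simp only [if_true, h0, if_false, add_zero] at key
    rw [hsum, mul_pow]
    obtain ⟨j, rfl⟩ : ∃ j, k = j + 1 := ⟨k - 1, by omega⟩
    rw [Nat.add_sub_cancel]
    calc (Fintype.card F : ℝ) ^ (j + 1) * η ^ (j + 1)
        = (Fintype.card F * η ^ (j + 1)) * (Fintype.card F : ℝ) ^ j := by ring
      _ ≤ _ := by gcongr

end FiniteField

/-! ### Products of fields and passage to `ZMod m`. -/

/-- Sets without nonzero `k`-th power differences in a product of finite fields in which `-1` is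
a `k`-th power. -/
theorem card_pow_le_of_forall_sub_ne_pow {ι : Type*} [Fintype ι] {F : ι → Type*}
    [∀ i, Field (F i)] [∀ i, Fintype (F i)] {k : ℕ} (hk : 0 < k)
    (hneg : ∀ i, ∃ z : F i, z ^ k = -1) (ψ : ∀ i, AddChar (F i) ℂ)
    (hψ : ∀ i, (ψ i).IsPrimitive) (A : Finset (∀ i, F i))
    (hA : ∀ x ∈ A, ∀ y ∈ A, x ≠ y → ¬ ∃ z : ∀ i, F i, x - y = z ^ k) :
    #A ^ k ≤ (∏ i, Fintype.card (F i)) ^ (k - 1) := by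
  classical
  choose W hW0 hWpos hWz hWk using fun i =>
    exists_weight_fourier_supported_on_powers (hψ i) hk (hneg i)
  let χ : (∀ i, F i) → AddChar (∀ i, F i) ℂ := fun τ =>
    ∏ i, ((ψ i).mulShift (τ i)).compAddMonoidHom (Pi.evalAddMonoidHom F i)
  have hχ : ∀ τ x, χ τ x = ∏ i, ψ i (τ i * x i) := fun τ x => by
    simp [χ, AddChar.prod_apply]
  have key := card_mul_weight_le_sum χ (fun τ => ∏ i, W i (τ i))
    (fun τ => Finset.prod_nonneg fun i _ => hW0 i _) 0
    (by ext x; simp [hχ]) A (fun x hx y hy hxy => by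
      have hex : ∃ i, ¬ ∃ z : F i, (x - y) i = z ^ k := by
        by_contra! hcon
        choose z hz using hcon
        exact hA x hx y hy hxy ⟨z, funext hz⟩
      obtain ⟨i, hi⟩ := hex
      simp_rw [hχ, Complex.ofReal_prod, ← Finset.prod_mul_distrib]
      rw [← Fintype.piFinset_univ, ← Finset.prod_univ_sum
        (t := fun i => (univ : Finset (F i)))
        (f := fun i t => (W i t : ℂ) * ψ i (t * (x - y) i))]
      exact Finset.prod_eq_zero (mem_univ i) (hWz i _ hi))
  have hsum : ∑ τ : ∀ i, F i, ∏ i, W i (τ i) = ∏ i, ∑ t, W i t := by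
    rw [Finset.prod_univ_sum, Fintype.piFinset_univ]
  rw [hsum] at key
  simp only [Pi.zero_apply] at key
  have hP : 0 < ∏ i, W i 0 := Finset.prod_pos fun i _ => hWpos i
  have hfin : (#A : ℝ) ^ k * (∏ i, W i 0) ^ k
      ≤ (∏ i, (Fintype.card (F i) : ℝ)) ^ (k - 1) * (∏ i, W i 0) ^ k := by
    calc _ = (#A * ∏ i, W i 0) ^ k := (mul_pow _ _ _).symm
      _ ≤ (∏ i, ∑ t, W i t) ^ k := pow_le_pow_left₀ (by positivity) key k
      _ = ∏ i, (∑ t, W i t) ^ k := (Finset.prod_pow _ _ _).symm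
      _ ≤ ∏ i, (W i 0 ^ k * (Fintype.card (F i) : ℝ) ^ (k - 1)) :=
        Finset.prod_le_prod
          (fun i _ => pow_nonneg (Finset.sum_nonneg fun t _ => hW0 i t) k) fun i _ => hWk i
      _ = _ := by rw [Finset.prod_mul_distrib, Finset.prod_pow, Finset.prod_pow, mul_comm]
  have := le_of_mul_le_mul_right hfin (pow_pos hP k)
  exact_mod_cast this

/-- Write `p - 1 = 2 ^ (s + 1) * c`. For a generator `g`, `g ^ (c * 2 ^ s)` squares to `1` without
being `1`, so it is `-1`, and the odd power `d` preserves this. -/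
theorem ZMod.exists_pow_eq_neg_one {p : ℕ} [Fact p.Prime] {d s : ℕ} (hd : Odd d)
    (hp : p ≡ 1 [MOD 2 ^ (s + 1)]) : ∃ z : ZMod p, z ^ (d * 2 ^ s) = -1 := by
  have hp2 := (Fact.out : p.Prime).two_le
  obtain ⟨c, hc⟩ := (Nat.modEq_iff_dvd' (by omega)).1 hp.symm
  obtain ⟨g, hg⟩ := IsCyclic.exists_generator (α := (ZMod p)ˣ)
  have hord : orderOf (g : ZMod p) = p - 1 := by
    rw [orderOf_units, orderOf_eq_card_of_forall_mem_zpowers hg, Nat.card_eq_fintype_card,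
      ZMod.card_units]
  have hc0 : 0 < c := by
    rcases Nat.eq_zero_or_pos c with rfl | h
    · omega
    · exact h
  refine ⟨(g : ZMod p) ^ c, ?_⟩
  have hsq : ((g : ZMod p) ^ (c * 2 ^ s)) ^ 2 = 1 := by
    rw [← pow_mul, show c * 2 ^ s * 2 = p - 1 by rw [hc]; ring, ← hord, pow_orderOf_eq_one]
  have hne : (g : ZMod p) ^ (c * 2 ^ s) ≠ 1 := by
    intro h
    have hle := Nat.le_of_dvd (by positivity) (orderOf_dvd_of_pow_eq_one h)
    rw [hord, hc, pow_succ] at hle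
    have : 0 < c * 2 ^ s := by positivity
    nlinarith
  rw [← pow_mul, mul_comm d, ← mul_assoc, pow_mul, (eq_or_eq_neg_of_sq_eq_sq _ _ (hsq.trans (one_pow 2).symm)).resolve_left hne,
    hd.neg_one_pow]

/-- At a prime dividing `m` exactly once, equality would force `k ∣ k - 1`. -/
theorem pow_ne_pow_pred_of_squarefree {m : ℕ} (hm : 1 < m) (hsq : Squarefree m) {k : ℕ}
    (hk : 2 ≤ k) (a : ℕ) : a ^ k ≠ m ^ (k - 1) := by
  intro h
  obtain ⟨p, hp, hpm⟩ := Nat.exists_prime_and_dvd hm.ne'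
  have h1 : m.factorization p = 1 :=
    le_antisymm (hsq.natFactorization_le_one p)
      ((hp.dvd_iff_one_le_factorization (by omega)).1 hpm)
  have h2 := congrArg (fun n => n.factorization p) h
  simp only [Nat.factorization_pow, Finsupp.smul_apply, smul_eq_mul, h1, mul_one] at h2
  have h3 := Nat.le_of_dvd (by omega) (Dvd.intro _ h2)
  omega

theorem theorem2p6 (m : ℕ) (hm : 1 < m) (hsq : Squarefree m)
    (k d s : ℕ) (hk : 2 ≤ k) (hd : Odd d) (hkd : k = d * 2 ^ s)
    (hp : ∀ p : ℕ, p.Prime → p ∣ m → p ≡ 1 [MOD 2 ^ (s + 1)])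
    (A : Finset (ZMod m))
    (hA : ∀ x ∈ A, ∀ y ∈ A, x ≠ y → ¬ ∃ z : ZMod m, x - y = z ^ k) :
    (A.card : ℝ) < (m : ℝ) ^ (1 - 1 / (k : ℝ)) := by
  have hprime : ∀ p : m.primeFactors, (p : ℕ).Prime := fun p => Nat.prime_of_mem_primeFactors p.2
  have : ∀ p : m.primeFactors, Fact (p : ℕ).Prime := fun p => ⟨hprime p⟩
  have hprod : ∏ p : m.primeFactors, (p : ℕ) = m := by
    rw [Finset.prod_coe_sort m.primeFactors (fun p => p), Nat.prod_primeFactors_of_squarefree hsq]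
  have hcop : Pairwise (Function.onFun Nat.Coprime fun p : m.primeFactors => (p : ℕ)) :=
    fun p q hpq => (Nat.coprime_primes (hprime p) (hprime q)).2 fun h => hpq (Subtype.ext h)
  let e : ZMod m ≃+* ∀ p : m.primeFactors, ZMod (p : ℕ) :=
    (ZMod.ringEquivCongr hprod.symm).trans (ZMod.prodEquivPi _ hcop)
  have hle := card_pow_le_of_forall_sub_ne_pow (F := fun p : m.primeFactors => ZMod (p : ℕ))
    (k := k) (by omega)
    (fun p => hkd ▸ ZMod.exists_pow_eq_neg_one hd
      (hp p (hprime p) (Nat.dvd_of_mem_primeFactors p.2)))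
    (fun p => ZMod.stdAddChar) (fun p => ZMod.isPrimitive_stdAddChar p)
    (A.map e.toEquiv.toEmbedding) (by
      intro x hx y hy hxy ⟨z, hz⟩
      obtain ⟨a, ha, rfl⟩ := Finset.mem_map.1 hx
      obtain ⟨b, hb, rfl⟩ := Finset.mem_map.1 hy
      refine hA a ha b hb (fun h => hxy (by rw [h])) ⟨e.symm z, e.injective ?_⟩
      rw [map_sub, map_pow, e.apply_symm_apply]
      exact hz)
  simp only [Finset.card_map, ZMod.card, hprod] at hle
  have hlt : (#A : ℝ) ^ k < (m : ℝ) ^ (k - 1) := by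
    exact_mod_cast lt_of_le_of_ne hle (pow_ne_pow_pred_of_squarefree hm hsq hk _)
  refine lt_of_pow_lt_pow_left₀ k (by positivity) (hlt.trans_eq ?_)
  have hk0 : (k : ℝ) ≠ 0 := by positivity
  rw [← Real.rpow_natCast, ← Real.rpow_natCast, ← Real.rpow_mul (by positivity)]
  congr 1
  rw [Nat.cast_sub (by omega), Nat.cast_one]
  field_simp
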